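/- Let $n\in\mathbb{N}$ and $\mu>1$. Let $\Psi:\mathbb{C}^{2n+4}\to\mathbb{R}^2$, $\Psi(s,q,x,x_{n+1})=\big(|s|^2+|q|^2,\ |q|^2+|x|^2+|x_{n+1}|^2\big)$ with $s,x\in\mathbb{C}^{n+1}$ and $q,x_{n+1}\in\mathbb{C}$, be the moment map of the $T^2$-action $(\alpha,\beta)\cdot(s,q,x,x_{n+1})=(\alpha s,\alpha\beta q,\beta x,\beta x_{n+1})$. Let $\mathbb{F}=\Psi^{-1}(1,\mu)/T^2$, with points denoted $[s,q,x,x_{n+1}]$ and with the reduced symplectic form $\omega_{\mathbb{F}}$ of the standard form $\frac{i}{2}\sum dz_j\wedge d\bar z_j$. Let $$\mathcal{X}=\{([s,q,x,x_{n+1}],[t_0:t_1])\in\mathbb{F}\times\mathbb{CP}^1 : t_1(s_0x_0+\cdots+s_nx_n)=t_0q\},$$ let $\pi:\mathcal{X}\to\mathbb{CP}^1$ be the projection, $\mathcal{X}_t=\pi^{-1}(t)$ where $t=t_0/t_1\in\mathbb{C}\cup\{\infty\}$, and let $\Omega^\mu$ be the pull-back of $\omega_{\mathbb{F}}$ to $\mathcal{X}$.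 The only critical point of $\pi$ is $z_{\mathrm{crit}}=([0,1,0,\sqrt{\mu-1}],0)$. For a smoothly embedded path $\gamma:[a,b]\to\mathbb{CP}^1$ with $\gamma(b)=0$, the vanishing cycle $V_\gamma\subset\mathcal{X}_{\gamma(a)}$ is the set of all $z\in\mathcal{X}_{\gamma(a)}$ whose parallel transport along $\gamma|_{[a,r]}$, with respect to the connection given by the $\Omega^\mu$-orthogonal complements of the tangent spaces of the fibres, converges to $z_{\mathrm{crit}}$ as $r\to b$. Then, for every $t>0$ and every smoothly embedded path $\gamma$ in $\mathbb{CP}^1$ from $t$ to $0$, the vanishing cycle $V_\gamma$ is symplectically isotopic in $(\mathcal{X}_t,\Omega^\mu|_{\mathcal{X}_t})$ to $$\mathcal{V}^\mu_t=\{([\bar x,\sqrt{1-g(t)},x,\sqrt{\mu-1}],t)\in\mathcal{X} : |x|^2=g(t)\},\qquad g(t)=\frac{-t^2+\sqrt{t^4+4t^2}}{2}.$$ For every smoothly embedded path $\gamma$ in $\mathbb{CP}^1$ from $\infty$ to $0$, the vanishing cycle $V_\gamma$ is symplectically isotopic in $(\mathcal{X}_\infty,\Omega^\mu|_{\mathcal{X}_\infty})$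 to $$\mathcal{V}^\mu_\infty=\{([\bar x,0,x,\sqrt{\mu-1}],\infty)\in\mathcal{X} : |x|^2=1\}.$$ -/

import Mathlib

open Set Filter Topology
open scoped ContDiff

namespace VanishingCycle

/-! ### The toric manifold `F` as a symplectic quotient -/

/-- The coordinate space `ℂ^{2n+4}`, with points `p = (s, q, x, x_{n+1})`, where
`s = p.1`, `q = p.2.1`, `x = p.2.2.1` and `x_{n+1} = p.2.2.2`. -/
abbrev Coord (n : ℕ) : Type := (Fin (n + 1) → ℂ) × ℂ × (Fin (n + 1) → ℂ) × ℂ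

/-- The standard symplectic form `(i/2) ∑ dz ∧ dz̄` on `ℂ^{2n+4}`. -/
noncomputable def omegaStd {n : ℕ} (v w : Coord n) : ℝ :=
  ((∑ j, (starRingEnd ℂ) (v.1 j) * w.1 j) + (starRingEnd ℂ) v.2.1 * w.2.1
    + (∑ j, (starRingEnd ℂ) (v.2.2.1 j) * w.2.2.1 j)
    + (starRingEnd ℂ) v.2.2.2 * w.2.2.2).im

/-- The moment map `(|s|² + |q|², |q|² + |x|² + |x_{n+1}|²)` of the `T²`-action. -/
noncomputable def momentMap {n : ℕ} (p : Coord n) : ℝ × ℝ :=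
  ((∑ j, ‖p.1 j‖ ^ 2) + ‖p.2.1‖ ^ 2,
    ‖p.2.1‖ ^ 2 + (∑ j, ‖p.2.2.1 j‖ ^ 2) + ‖p.2.2.2‖ ^ 2)

/-- The level set of the moment map over `(1, μ)`. -/
def levelSet (n : ℕ) (μ : ℝ) : Set (Coord n) := {p | momentMap p = (1, μ)}

/-- The action of `(α, β) ∈ T²`: `(s, q, x, x_{n+1}) ↦ (α s, α β q, β x, β x_{n+1})`. -/
noncomputable def torusAct {n : ℕ} (α β : Circle) (p : Coord n) : Coord n :=
  (fun j => (α : ℂ) * p.1 j, (α : ℂ) * (β : ℂ) * p.2.1,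
    fun j => (β : ℂ) * p.2.2.1 j, (β : ℂ) * p.2.2.2)

theorem torusAct_one {n : ℕ} (p : Coord n) : torusAct 1 1 p = p := by
  simp [torusAct]

theorem torusAct_mul {n : ℕ} (α β α' β' : Circle) (p : Coord n) :
    torusAct α β (torusAct α' β' p) = torusAct (α * α') (β * β') p := by
  simp only [torusAct, Circle.coe_mul]
  refine Prod.ext ?_ (Prod.ext ?_ (Prod.ext ?_ ?_))
  · funext j; simp only; ring
  · simp only; ring
  · funext j; simp only; ring
  · simp only; ring

/-- The orbit equivalence relation of the `T²`-action on the level set. -/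
def torusSetoid (n : ℕ) (μ : ℝ) : Setoid (levelSet n μ) where
  r p p' := ∃ α β : Circle, torusAct α β p.1 = p'.1
  iseqv :=
    { refl := fun p => ⟨1, 1, torusAct_one p.1⟩
      symm := by
        rintro p p' ⟨α, β, h⟩
        refine ⟨α⁻¹, β⁻¹, ?_⟩
        rw [← h, torusAct_mul, inv_mul_cancel, inv_mul_cancel, torusAct_one]
      trans := by
        rintro p p' p'' ⟨α, β, h⟩ ⟨α', β', h'⟩
        exact ⟨α' * α, β' * β, by rw [← torusAct_mul, h, h']⟩ }

/-- The manifold `F = Ψ⁻¹(1, μ) / T²`; its points are the classes `[s, q, x, x_{n+1}]`. -/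
def FF (n : ℕ) (μ : ℝ) : Type := Quotient (torusSetoid n μ)

instance (n : ℕ) (μ : ℝ) : TopologicalSpace (FF n μ) :=
  inferInstanceAs (TopologicalSpace (Quotient (torusSetoid n μ)))

/-- The class `[s, q, x, x_{n+1}]` in `F` of a point of the level set. -/
def FF.mk {n : ℕ} {μ : ℝ} (p : Coord n) (hp : p ∈ levelSet n μ) : FF n μ :=
  Quotient.mk (torusSetoid n μ) ⟨p, hp⟩

/-! ### The fibration `π : X → ℂP¹` -/

/-- The complex projective line. The point `[t₀ : t₁]` is `Projectivization.mk ℂ ![t₀, t₁] _`;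
it corresponds to the number `t = t₀ / t₁`. -/
abbrev CP1 : Type := Projectivization ℂ (Fin 2 → ℂ)

instance : TopologicalSpace CP1 :=
  inferInstanceAs (TopologicalSpace (Quotient (projectivizationSetoid ℂ (Fin 2 → ℂ))))

/-- The point `t = [t : 1]` of `ℂP¹`. -/
noncomputable def CP1.ofComplex (t : ℂ) : CP1 :=
  Projectivization.mk ℂ ![t, 1] (fun h => one_ne_zero (α := ℂ) (by simpa using congrFun h 1))

/-- The point `∞ = [1 : 0]` of `ℂP¹`. -/
noncomputable def CP1.infinity : CP1 :=
  Projectivization.mk ℂ ![1, 0] (fun h => one_ne_zero (α := ℂ) (by simpa using congrFun h 0))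

/-- The defining function `t₁ (s₀ x₀ + ⋯ + s_n x_n) - t₀ q` of the fibre over `t = [t₀ : t₁]`.
Another choice of homogeneous coordinates of `t` multiplies it by a nonzero constant. -/
noncomputable def fibreEq {n : ℕ} (t : CP1) (p : Coord n) : ℂ :=
  t.rep 1 * (∑ j, p.1 j * p.2.2.1 j) - t.rep 0 * p.2.1

/-- The total space `X ⊆ F × ℂP¹`, cut out by `t₁ (s₀ x₀ + ⋯ + s_n x_n) = t₀ q`. The equation is
invariant under the torus action, so that one representative may be used. -/
def XX (n : ℕ) (μ : ℝ) : Type :=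
  {z : FF n μ × CP1 // ∃ (p : Coord n) (hp : p ∈ levelSet n μ),
    z.1 = FF.mk p hp ∧ fibreEq z.2 p = 0}

instance (n : ℕ) (μ : ℝ) : TopologicalSpace (XX n μ) :=
  instTopologicalSpaceSubtype

/-- The projection `π : X → ℂP¹`. -/
def proj {n : ℕ} {μ : ℝ} (z : XX n μ) : CP1 := z.1.2

/-- `p` is a representative in the level set of the `F`-component of `z`. -/
def IsRep {n : ℕ} {μ : ℝ} (p : Coord n) (z : XX n μ) : Prop :=
  ∃ hp : p ∈ levelSet n μ, z.1.1 = FF.mk p hp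

theorem node_mem_levelSet (n : ℕ) {μ : ℝ} (hμ : 1 < μ) :
    ((0, 1, 0, (Real.sqrt (μ - 1) : ℂ)) : Coord n) ∈ levelSet n μ := by
  have h : (0 : ℝ) ≤ μ - 1 := by linarith
  simp [levelSet, momentMap, Complex.norm_real, Real.sq_sqrt h]

/-- The critical point `z_crit = ([0, 1, 0, √(μ - 1)], 0)` of `π`. -/
noncomputable def zCrit (n : ℕ) {μ : ℝ} (hμ : 1 < μ) : XX n μ :=
  ⟨(FF.mk _ (node_mem_levelSet n hμ), CP1.ofComplex 0), _, node_mem_levelSet n hμ, rfl, by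
    have h : (CP1.ofComplex 0).rep 0 = 0 := by
      obtain ⟨a, ha⟩ := Projectivization.exists_smul_eq_mk_rep ℂ (![0, 1] : Fin 2 → ℂ)
        (fun h => one_ne_zero (α := ℂ) (by simpa using congrFun h 1))
      rw [CP1.ofComplex, ← ha]
      simp
    simp [fibreEq, h]⟩

/-! ### The symplectic connection and the vanishing cycle -/

/-- `v ∈ ℂ^{2n+4}` represents a vector tangent to the fibre of `π` over `t` at the point with
representative `p`: it is tangent to the level set and to the zero set of `fibreEq t`. -/
def IsVertical {n : ℕ} (t : CP1) (p v : Coord n) : Prop :=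
  fderiv ℝ (momentMap (n := n)) p v = 0 ∧ fderiv ℝ (fibreEq (n := n) t) p v = 0

/-- `w` (tangent to the level set at `p`) represents a vector which is horizontal at the point
with representative `p` of the fibre over `t`, i.e. orthogonal with respect to `Ω^μ` to the tangent
space of the fibre. The form `Ω^μ` is the pull-back of the reduced form on `F`, whose value on two
tangent vectors is the value of `omegaStd` on representatives. -/
def IsHorizontal {n : ℕ} (t : CP1) (p w : Coord n) : Prop :=
  ∀ v : Coord n, IsVertical t p v → omegaStd w v = 0

/-- The curve `c` in `X` is, on `[r₁, r₂]`, a horizontal lift of the path `γ` in `ℂP¹`. -/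
def IsHorizontalLift {n : ℕ} {μ : ℝ} (γ : ℝ → CP1) (r₁ r₂ : ℝ) (c : ℝ → XX n μ) : Prop :=
  (∀ r ∈ Icc r₁ r₂, proj (c r) = γ r) ∧
  ∃ p : ℝ → Coord n, ContDiffOn ℝ 1 p (Icc r₁ r₂) ∧
    ∀ r ∈ Icc r₁ r₂, IsRep (p r) (c r) ∧
      IsHorizontal (γ r) (p r) (derivWithin p (Icc r₁ r₂) r)

/-- `z'` is the parallel transport of `z` along `γ` restricted to `[r₁, r₂]`. -/
def IsParallelTransport {n : ℕ} {μ : ℝ} (γ : ℝ → CP1) (r₁ r₂ : ℝ) (z z' : XX n μ) : Prop :=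
  ∃ c : ℝ → XX n μ, IsHorizontalLift γ r₁ r₂ c ∧ c r₁ = z ∧ c r₂ = z'

/-- The ball `B_γ` of a path `γ` on `[a, b]` that ends at the critical value: the critical point
together with all points in the fibres over `γ(r)`, `a ≤ r < b`, whose parallel transport along
`γ` restricted to `[r, r']` converges to the critical point as `r'` tends to `b`. -/
def vanishingBall {n : ℕ} {μ : ℝ} (hμ : 1 < μ) (γ : ℝ → CP1) (a b : ℝ) : Set (XX n μ) :=
  {zCrit n hμ} ∪ ⋃ r ∈ Ico a b, {z | proj z = γ r ∧ ∃ ρ : ℝ → XX n μ,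
    (∀ r' ∈ Ico r b, IsParallelTransport γ r r' z (ρ r')) ∧
    Tendsto ρ (𝓝[<] b) (𝓝 (zCrit n hμ))}

/-- The vanishing cycle `V_γ = B_γ ∩ π⁻¹(γ(a))` associated to the path `γ`. -/
def vanishingCycle {n : ℕ} {μ : ℝ} (hμ : 1 < μ) (γ : ℝ → CP1) (a b : ℝ) : Set (XX n μ) :=
  vanishingBall hμ γ a b ∩ {z | proj z = γ a}

/-- `γ` is, on `[a, b]`, a smoothly embedded path in `ℂP¹`: injective, and given by smooth
homogeneous coordinates `[u₀ : u₁]` whose Wronskian vanishes nowhere, that is, with nonvanishing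
velocity. -/
structure IsEmbeddedPath (γ : ℝ → CP1) (a b : ℝ) : Prop where
  lt : a < b
  injOn : InjOn γ (Icc a b)
  smooth : ∃ u : ℝ → Fin 2 → ℂ, ContDiffOn ℝ ∞ u (Icc a b) ∧ ∀ r ∈ Icc a b,
    (∃ h : u r ≠ 0, γ r = Projectivization.mk ℂ (u r) h) ∧
    u r 0 * derivWithin u (Icc a b) r 1 - u r 1 * derivWithin u (Icc a b) r 0 ≠ 0

/-! ### Symplectic isotopy in a nonsingular fibre -/

/-- The fibre `X_t = π⁻¹(t)`. -/
def Fibre (n : ℕ) (μ : ℝ) (t : CP1) : Type := {z : XX n μ // proj z = t}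

/-- `f` is smooth on the open set `U ⊆ ℝ^k` as a map into the fibre (for `t ≠ 0`, a submanifold of
`F × {t}`): locally, it has smooth representatives in the level set. -/
def IsPlot {n : ℕ} {μ : ℝ} {t : CP1} {k : ℕ} (U : Set (Fin k → ℝ))
    (f : (Fin k → ℝ) → Fibre n μ t) : Prop :=
  ∀ y ∈ U, ∃ W : Set (Fin k → ℝ), IsOpen W ∧ y ∈ W ∧ ∃ p : (Fin k → ℝ) → Coord n,
    ContDiffOn ℝ ∞ p W ∧ ∀ y' ∈ W, IsRep (p y') (f y').1

/-- The map `(τ, z) ↦ φ τ z` from `ℝ × X_t` to `X_t` is smooth: its composition with every smooth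
map from an open subset of some `ℝ^k` to `ℝ × X_t` is smooth. -/
def IsSmoothFamily {n : ℕ} {μ : ℝ} {t : CP1} (φ : ℝ → Fibre n μ t → Fibre n μ t) : Prop :=
  ∀ (k : ℕ) (U : Set (Fin k → ℝ)) (τ : (Fin k → ℝ) → ℝ) (f : (Fin k → ℝ) → Fibre n μ t),
    IsOpen U → ContDiffOn ℝ ∞ τ U → IsPlot U f → IsPlot U (fun y => φ (τ y) (f y))

/-- The smooth map `φ : X_t → X_t` satisfies `φ^* Ω^μ = Ω^μ`. This is tested on smooth
two-parameter families `y ↦ f y` in `X_t`; the form is evaluated on smooth representatives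
`p` of `f` and `p'` of `φ ∘ f`, whose choice does not matter. -/
def PreservesForm {n : ℕ} {μ : ℝ} {t : CP1} (φ : Fibre n μ t → Fibre n μ t) : Prop :=
  ∀ (U : Set (Fin 2 → ℝ)) (f : (Fin 2 → ℝ) → Fibre n μ t) (p : (Fin 2 → ℝ) → Coord n),
    IsOpen U → ContDiffOn ℝ ∞ p U → (∀ y ∈ U, IsRep (p y) (f y).1) →
    ∀ y ∈ U, ∃ W : Set (Fin 2 → ℝ), IsOpen W ∧ y ∈ W ∧ ∃ p' : (Fin 2 → ℝ) → Coord n,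
      ContDiffOn ℝ ∞ p' W ∧ (∀ y' ∈ W, IsRep (p' y') (φ (f y')).1) ∧
      ∀ v w : Fin 2 → ℝ,
        omegaStd (fderiv ℝ p' y v) (fderiv ℝ p' y w) = omegaStd (fderiv ℝ p y v) (fderiv ℝ p y w)

/-- The subsets `V` and `V'` of the fibre `X_t` are symplectically isotopic in
`(X_t, Ω^μ)`: there is a smooth family `φ τ` of symplectomorphisms of `X_t` with `φ 0 = id` that
takes `V` to `V'` at time `1`. -/
def SymplecticallyIsotopic {n : ℕ} {μ : ℝ} (t : CP1) (V V' : Set (XX n μ)) : Prop :=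
  V ⊆ {z | proj z = t} ∧ V' ⊆ {z | proj z = t} ∧
  ∃ φ : ℝ → Fibre n μ t ≃ Fibre n μ t,
    φ 0 = Equiv.refl _ ∧
    IsSmoothFamily (fun τ z => φ τ z) ∧ IsSmoothFamily (fun τ z => (φ τ).symm z) ∧
    (∀ τ, PreservesForm (φ τ)) ∧
    φ 1 '' {z | z.1 ∈ V} = {z | z.1 ∈ V'}

/-! ### The explicit spheres -/

/-- `g(t) = (-t² + √(t⁴ + 4t²)) / 2`. -/
noncomputable def g (t : ℝ) : ℝ := (-t ^ 2 + Real.sqrt (t ^ 4 + 4 * t ^ 2)) / 2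

/-- `{([x̄, √(1 - g(t)), x, √(μ - 1)], t) ∈ X : |x|² = g(t)}`. -/
def sphere (n : ℕ) (μ t : ℝ) : Set (XX n μ) :=
  {z | proj z = CP1.ofComplex t ∧ ∃ x : Fin (n + 1) → ℂ, ∑ j, ‖x j‖ ^ 2 = g t ∧
    IsRep (fun j => (starRingEnd ℂ) (x j), (Real.sqrt (1 - g t) : ℂ), x,
      (Real.sqrt (μ - 1) : ℂ)) z}

/-- `{([x̄, 0, x, √(μ - 1)], ∞) ∈ X : |x|² = 1}`. -/
def sphereAtInfinity (n : ℕ) (μ : ℝ) : Set (XX n μ) :=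
  {z | proj z = CP1.infinity ∧ ∃ x : Fin (n + 1) → ℂ, ∑ j, ‖x j‖ ^ 2 = 1 ∧
    IsRep (fun j => (starRingEnd ℂ) (x j), 0, x, (Real.sqrt (μ - 1) : ℂ)) z}

end VanishingCycle

namespace VanishingCycle

open ComplexConjugate

variable {n : ℕ} {μ : ℝ}

/-! The vanishing cycle does not depend on the path: it equals the explicit sphere, so the constant
isotopy suffices. The action `(s, x) ↦ (Ā s, A x)` of `U(n + 1)` and the rotation of `x_{n+1}`
preserve the symplectic form and every fibre. Their infinitesimal generators are therefore vertical,
so horizontal vectors annihilate the differentials of their moment maps, and parallel transport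
conserves `unitaryMoment` and `lastMoment` (`IsParallelTransport.moments_eq`). A point transported
to `zCrit` must share its moments `0` and `μ - 1`, which forces a representative `(x̄, q, x, √(μ -
1))` (`vanishingCycle_subset_isotropicSphere`). Conversely, write the base point as `[1 : σ]`, so
that `σ = 1 / t`. Over it such a point has `q = σ |x|²`, and the level set condition becomes `|σ|²
|x|⁴ + |x|² = 1`, which fixes `|x|`. The curve `x = ζ ξ`, with `ξ` a fixed unit vector, `|ζ|` the
positive root and a suitable phase of `ζ`, is horizontal (`exists_transport_factor`,
`isHorizontal_transport`). As `σ → ∞`, `|ζ| → 0` and `|q| → 1`, so the curve tends to `zCrit`. -/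

/-! ### Representatives, homogeneous coordinates and limits in the quotients. -/

theorem mem_levelSet_iff {p : Coord n} :
    p ∈ levelSet n μ ↔ (∑ j, ‖p.1 j‖ ^ 2) + ‖p.2.1‖ ^ 2 = 1 ∧
      ‖p.2.1‖ ^ 2 + (∑ j, ‖p.2.2.1 j‖ ^ 2) + ‖p.2.2.2‖ ^ 2 = μ := by
  simp [levelSet, momentMap]

theorem torusAct_mem_levelSet (α β : Circle) {p : Coord n} (hp : p ∈ levelSet n μ) :
    torusAct α β p ∈ levelSet n μ := by
  rw [mem_levelSet_iff] at hp ⊢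
  simpa [torusAct, Circle.norm_coe] using hp

theorem FF.mk_eq_mk {p p' : Coord n} {hp : p ∈ levelSet n μ} {hp' : p' ∈ levelSet n μ} :
    FF.mk p hp = FF.mk p' hp' ↔ ∃ α β : Circle, torusAct α β p = p' :=
  Quotient.eq (r := torusSetoid n μ)

theorem IsRep.torusAct {p : Coord n} {z : XX n μ} (h : IsRep p z) (α β : Circle) :
    IsRep (torusAct α β p) z := by
  obtain ⟨hp, hz⟩ := h
  exact ⟨torusAct_mem_levelSet α β hp, hz.trans (FF.mk_eq_mk.2 ⟨α, β, rfl⟩)⟩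

theorem IsRep.mem {p : Coord n} {z : XX n μ} (h : IsRep p z) : p ∈ levelSet n μ := h.1

theorem exists_isRep (z : XX n μ) : ∃ p : Coord n, IsRep p z := by
  obtain ⟨p, hp, h, -⟩ := z.2
  exact ⟨p, hp, h⟩

theorem fibreEq_torusAct (t : CP1) (α β : Circle) (p : Coord n) :
    fibreEq t (torusAct α β p) = α * β * fibreEq t p := by
  simp only [fibreEq, torusAct]
  have : ∑ j, (α : ℂ) * p.1 j * ((β : ℂ) * p.2.2.1 j) = α * β * ∑ j, p.1 j * p.2.2.1 j := by
    rw [Finset.mul_sum]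
    exact Finset.sum_congr rfl fun j _ => by ring
  rw [this]
  ring

/-- The definition of `XX` gives the equation for one representative only; equivariance of `fibreEq`
carries it to all of them. -/
theorem IsRep.fibreEq_eq_zero {p : Coord n} {z : XX n μ} (h : IsRep p z) :
    fibreEq (proj z) p = 0 := by
  obtain ⟨p', hp', hz', h0⟩ := z.2
  obtain ⟨hp, hz⟩ := h
  obtain ⟨α, β, rfl⟩ := FF.mk_eq_mk.1 (hz'.symm.trans hz)
  rw [fibreEq_torusAct]
  simp [proj, h0]

theorem XX.ext_of_isRep {p : Coord n} {z z' : XX n μ} (h : IsRep p z) (h' : IsRep p z')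
    (hπ : proj z = proj z') : z = z' :=
  Subtype.ext (Prod.ext (h.2.trans h'.2.symm) hπ)

theorem rep_mk (u : Fin 2 → ℂ) (hu : u ≠ 0) :
    ∃ c : ℂ, c ≠ 0 ∧ ∀ i, (Projectivization.mk ℂ u hu).rep i = c * u i := by
  obtain ⟨c, hc⟩ := Projectivization.exists_smul_eq_mk_rep ℂ u hu
  exact ⟨c, c.ne_zero, fun i => by rw [← hc]; rfl⟩

theorem fibreEq_mk_eq_zero_iff (u : Fin 2 → ℂ) (hu : u ≠ 0) (p : Coord n) :
    fibreEq (Projectivization.mk ℂ u hu) p = 0 ↔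
      u 1 * (∑ j, p.1 j * p.2.2.1 j) = u 0 * p.2.1 := by
  obtain ⟨c, hc, h⟩ := rep_mk u hu
  rw [fibreEq, h, h, mul_assoc, mul_assoc, ← mul_sub, mul_eq_zero_iff_left hc, sub_eq_zero]

theorem tendsto_FF_mk {ι : Type*} {l : Filter ι} {F : ι → FF n μ} {P : ι → Coord n}
    {p₀ : Coord n} (h₀ : p₀ ∈ levelSet n μ) (hP : Tendsto P l (𝓝 p₀))
    (hF : ∀ᶠ r in l, ∃ h : P r ∈ levelSet n μ, F r = FF.mk (P r) h) :
    Tendsto F l (𝓝 (FF.mk p₀ h₀)) := by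
  rw [tendsto_nhds]
  intro O hO hmem
  have hO' : IsOpen ((fun p : levelSet n μ => FF.mk p.1 p.2) ⁻¹' O) :=
    hO.preimage (continuous_quotient_mk' (s := torusSetoid n μ))
  obtain ⟨V, hV, hVO⟩ := isOpen_induced_iff.1 hO'
  have hp₀ : p₀ ∈ V := by
    have : (⟨p₀, h₀⟩ : levelSet n μ) ∈ Subtype.val ⁻¹' V := by rw [hVO]; exact hmem
    exact this
  filter_upwards [hP.eventually (hV.mem_nhds hp₀), hF] with r hr ⟨h, hFr⟩
  have : (⟨P r, h⟩ : levelSet n μ) ∈ (fun p : levelSet n μ => FF.mk p.1 p.2) ⁻¹' O := by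
    rw [← hVO]; exact hr
  rw [Set.mem_preimage, hFr]
  exact this

theorem tendsto_CP1_mk {ι : Type*} {l : Filter ι} {F : ι → CP1} {u : ι → Fin 2 → ℂ}
    {u₀ : Fin 2 → ℂ} (h₀ : u₀ ≠ 0) (hu : Tendsto u l (𝓝 u₀))
    (hF : ∀ᶠ r in l, ∃ h : u r ≠ 0, F r = Projectivization.mk ℂ (u r) h) :
    Tendsto F l (𝓝 (Projectivization.mk ℂ u₀ h₀)) := by
  rw [tendsto_nhds]
  intro O hO hmem
  have hO' : IsOpen
      ((fun v : {v : Fin 2 → ℂ // v ≠ 0} => Projectivization.mk ℂ v.1 v.2) ⁻¹' O) :=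
    hO.preimage (continuous_quotient_mk' (s := projectivizationSetoid ℂ (Fin 2 → ℂ)))
  obtain ⟨V, hV, hVO⟩ := isOpen_induced_iff.1 hO'
  have hp₀ : u₀ ∈ V := by
    have : (⟨u₀, h₀⟩ : {v : Fin 2 → ℂ // v ≠ 0}) ∈ Subtype.val ⁻¹' V := by rw [hVO]; exact hmem
    exact this
  filter_upwards [hu.eventually (hV.mem_nhds hp₀), hF] with r hr ⟨h, hFr⟩
  have : (⟨u r, h⟩ : {v : Fin 2 → ℂ // v ≠ 0}) ∈
      (fun v : {v : Fin 2 → ℂ // v ≠ 0} => Projectivization.mk ℂ v.1 v.2) ⁻¹' O := by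
    rw [← hVO]; exact hr
  rw [Set.mem_preimage, hFr]
  exact this

theorem exists_circle_mul_eq_norm (w : ℂ) : ∃ α : Circle, (α : ℂ) * w = ‖w‖ := by
  by_cases hw : w = 0
  · exact ⟨1, by simp [hw]⟩
  · have hw' : (‖w‖ : ℂ) ≠ 0 := by simpa using hw
    refine ⟨⟨conj w / ‖w‖, ?_⟩, ?_⟩
    · simp [Submonoid.unitSphere, hw]
    · change conj w / ‖w‖ * w = ‖w‖
      rw [div_mul_eq_mul_div, Complex.conj_mul', sq, mul_div_assoc, div_self hw', mul_one]

/-! ### Vertical tangent vectors in coordinates. -/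

theorem fderiv_momentMap_apply (p v : Coord n) :
    fderiv ℝ (momentMap (n := n)) p v =
      (2 * ((∑ j, conj (p.1 j) * v.1 j) + conj p.2.1 * v.2.1).re,
        2 * (conj p.2.1 * v.2.1 + (∑ j, conj (p.2.2.1 j) * v.2.2.1 j)
          + conj p.2.2.2 * v.2.2.2).re) := by
  have hd : DifferentiableAt ℝ (momentMap (n := n)) p := by
    unfold momentMap
    simp only [← Complex.normSq_eq_norm_sq, Complex.normSq_apply]
    have hre : Differentiable ℝ Complex.re := Complex.reCLM.differentiable
    have him : Differentiable ℝ Complex.im := Complex.imCLM.differentiable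
    fun_prop
  have key (a b : ℂ) : HasDerivAt (fun t : ℝ => ‖a + t • b‖ ^ 2) (2 * (conj a * b).re) 0 := by
    have h : HasDerivAt (fun t : ℝ => a + t • b) b 0 := by
      simpa using ((hasDerivAt_id (0 : ℝ)).smul_const b).const_add a
    have := h.norm_sq
    simpa [Complex.inner, mul_comm] using this
  rw [← hd.lineDeriv_eq_fderiv]
  refine HasDerivAt.deriv (HasDerivAt.prodMk ?_ ?_)
  · have := (HasDerivAt.fun_sum (u := Finset.univ) fun j _ => key (p.1 j) (v.1 j)).add (key p.2.1 v.2.1)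
    refine this.congr_deriv ?_
    simp only [Complex.add_re, Complex.re_sum, mul_add, Finset.mul_sum]
  · have := ((key p.2.1 v.2.1).add
      (HasDerivAt.fun_sum (u := Finset.univ) fun j _ => key (p.2.2.1 j) (v.2.2.1 j))).add (key p.2.2.2 v.2.2.2)
    refine this.congr_deriv ?_
    simp only [Complex.add_re, Complex.re_sum, mul_add, Finset.mul_sum]

theorem fderiv_fibreEq_apply (t : CP1) (p v : Coord n) :
    fderiv ℝ (fibreEq (n := n) t) p v =
      t.rep 1 * (∑ j, (v.1 j * p.2.2.1 j + p.1 j * v.2.2.1 j)) - t.rep 0 * v.2.1 := by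
  have hd : DifferentiableAt ℝ (fibreEq (n := n) t) p := by
    unfold fibreEq
    fun_prop
  rw [← hd.lineDeriv_eq_fderiv]
  refine HasDerivAt.deriv ?_
  have key (a b : ℂ) : HasDerivAt (fun t : ℝ => a + t • b) b 0 := by
    simpa using ((hasDerivAt_id (0 : ℝ)).smul_const b).const_add a
  have := ((HasDerivAt.fun_sum (u := Finset.univ) fun j _ =>
    (key (p.1 j) (v.1 j)).mul (key (p.2.2.1 j) (v.2.2.1 j))).const_mul (t.rep 1)).sub
      ((key p.2.1 v.2.1).const_mul (t.rep 0))
  refine this.congr_deriv ?_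
  simp

theorem isVertical_iff {t : CP1} {p v : Coord n} :
    IsVertical t p v ↔
      ((∑ j, conj (p.1 j) * v.1 j) + conj p.2.1 * v.2.1).re = 0 ∧
      (conj p.2.1 * v.2.1 + (∑ j, conj (p.2.2.1 j) * v.2.2.1 j) + conj p.2.2.2 * v.2.2.2).re = 0 ∧
      t.rep 1 * (∑ j, (v.1 j * p.2.2.1 j + p.1 j * v.2.2.1 j)) = t.rep 0 * v.2.1 := by
  rw [IsVertical, fderiv_momentMap_apply, fderiv_fibreEq_apply, Prod.mk_eq_zero, sub_eq_zero,
    and_assoc]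
  simp


/-! ### Moment maps conserved by parallel transport. -/

/-- The entries of the moment map of the action `(s, x) ↦ (Ā s, A x)` of `U(n + 1)` on `F`. -/
noncomputable def unitaryMoment (j k : Fin (n + 1)) : FF n μ → ℂ :=
  Quotient.lift
    (fun p : levelSet n μ => p.1.2.2.1 j * conj (p.1.2.2.1 k) - conj (p.1.1 j) * p.1.1 k) (by
      rintro p p' ⟨α, β, h⟩
      have hα : conj (α : ℂ) * α = 1 := by rw [Complex.conj_mul', Circle.norm_coe]; simp
      have hβ : (β : ℂ) * conj (β : ℂ) = 1 := by rw [Complex.mul_conj', Circle.norm_coe]; simp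
      simp only [← h, torusAct, map_mul]
      linear_combination (-(p.1.2.2.1 j * conj (p.1.2.2.1 k))) * hβ
        + (conj (p.1.1 j) * p.1.1 k) * hα)

/-- The moment map, up to scale, of the rotation of the coordinate `x_{n+1}` on `F`. -/
noncomputable def lastMoment : FF n μ → ℂ :=
  Quotient.lift (fun p : levelSet n μ => conj p.1.2.2.2 * p.1.2.2.2) (by
      rintro p p' ⟨α, β, h⟩
      have hβ : conj (β : ℂ) * β = 1 := by rw [Complex.conj_mul', Circle.norm_coe]; simp
      simp only [← h, torusAct, map_mul]
      linear_combination (-(conj p.1.2.2.2 * p.1.2.2.2)) * hβ)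

theorem unitaryMoment_mk (j k : Fin (n + 1)) (p : Coord n) (hp : p ∈ levelSet n μ) :
    unitaryMoment j k (FF.mk p hp) = p.2.2.1 j * conj (p.2.2.1 k) - conj (p.1 j) * p.1 k :=
  rfl

theorem lastMoment_mk (p : Coord n) (hp : p ∈ levelSet n μ) :
    lastMoment (FF.mk p hp) = conj p.2.2.2 * p.2.2.2 :=
  rfl

theorem continuous_unitaryMoment (j k : Fin (n + 1)) :
    Continuous (unitaryMoment j k : FF n μ → ℂ) :=
  Continuous.quotient_lift (s := torusSetoid n μ) (by fun_prop) _

theorem continuous_lastMoment : Continuous (lastMoment : FF n μ → ℂ) :=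
  Continuous.quotient_lift (s := torusSetoid n μ) (by fun_prop) _

/-- The left-hand side is the derivative of `unitaryMoment j k` in the direction `w`. It vanishes
because the generators of the unitary action are vertical. -/
theorem IsHorizontal.unitary_identity {t : CP1} {p w : Coord n} (h : IsHorizontal t p w)
    (j k : Fin (n + 1)) :
    w.2.2.1 j * conj (p.2.2.1 k) + p.2.2.1 j * conj (w.2.2.1 k)
      - (conj (w.1 j) * p.1 k + conj (p.1 j) * w.1 k) = 0 := by
  have key (c : ℂ) : (c * (conj (w.2.2.1 j) * p.2.2.1 k + w.2.2.1 k * conj (p.2.2.1 j)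
      - conj (w.1 k) * p.1 j - w.1 j * conj (p.1 k))).im = 0 := by
    -- The skew-Hermitian matrix `c E_jk - c̄ E_kj` acts on `x`, and its complex conjugate on `s`.
    have hv : IsVertical t p ((Pi.single j (conj c * p.1 k) - Pi.single k (c * p.1 j), 0,
        Pi.single j (c * p.2.2.1 k) - Pi.single k (conj c * p.2.2.1 j), 0) : Coord n) := by
      rw [isVertical_iff]
      simp only [Pi.sub_apply, Pi.single_apply, mul_sub, sub_mul, mul_ite, ite_mul, mul_zero,
        zero_mul, Finset.sum_sub_distrib, Finset.sum_add_distrib, Finset.sum_ite_eq',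
        Finset.mem_univ, if_true, Complex.add_re, Complex.sub_re, Complex.mul_re, Complex.mul_im,
        Complex.conj_re, Complex.conj_im, Complex.zero_re]
      refine ⟨by ring, by ring, by ring⟩
    have := h _ hv
    rw [← this, omegaStd]
    simp only [Pi.sub_apply, Pi.single_apply, mul_sub, mul_ite, mul_zero,
      Finset.sum_sub_distrib, Finset.sum_ite_eq',
      Finset.mem_univ, if_true, Complex.add_re, Complex.add_im, Complex.sub_im,
      Complex.mul_re, Complex.mul_im,
      Complex.conj_re, Complex.conj_im, Complex.zero_im]
    ring
  -- The values `c = 1` and `c = i` give the imaginary and the real part.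
  have h1 := key 1
  have h2 := key Complex.I
  simp only [Complex.add_re, Complex.sub_re, Complex.add_im, Complex.sub_im, Complex.mul_re,
    Complex.mul_im, Complex.conj_re, Complex.conj_im, Complex.one_re, Complex.one_im,
    Complex.I_re, Complex.I_im] at h1 h2
  apply Complex.ext <;>
  simp only [Complex.add_re, Complex.sub_re, Complex.add_im, Complex.sub_im, Complex.mul_re,
    Complex.mul_im, Complex.conj_re, Complex.conj_im, Complex.zero_re, Complex.zero_im] <;>
  linarith

theorem IsHorizontal.last_identity {t : CP1} {p w : Coord n} (h : IsHorizontal t p w) :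
    conj w.2.2.2 * p.2.2.2 + conj p.2.2.2 * w.2.2.2 = 0 := by
  have hv : IsVertical t p ((0, 0, 0, Complex.I * p.2.2.2) : Coord n) := by
    rw [isVertical_iff]
    refine ⟨by simp, ?_, by simp⟩
    simp
    ring
  have := h _ hv
  simp [omegaStd] at this
  apply Complex.ext <;> simp <;> linarith

theorem eq_of_hasDerivWithinAt_zero {f f' : ℝ → ℂ} {a b : ℝ} (hab : a ≤ b)
    (h : ∀ r ∈ Icc a b, HasDerivWithinAt f (f' r) (Icc a b) r) (h0 : ∀ r ∈ Icc a b, f' r = 0) :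
    f b = f a := by
  refine constant_of_derivWithin_zero (fun r hr => (h r hr).differentiableWithinAt) ?_ b
    (right_mem_Icc.2 hab)
  intro r hr
  have hlt := hr.1.trans_lt hr.2
  rw [(h r (Ico_subset_Icc_self hr)).derivWithin (uniqueDiffOn_Icc hlt r (Ico_subset_Icc_self hr)),
    h0 r (Ico_subset_Icc_self hr)]

theorem IsParallelTransport.moments_eq {γ : ℝ → CP1} {a b : ℝ} (hab : a ≤ b) {z z' : XX n μ}
    (h : IsParallelTransport γ a b z z') :
    (∀ j k, unitaryMoment j k z'.1.1 = unitaryMoment j k z.1.1) ∧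
      lastMoment z'.1.1 = lastMoment z.1.1 := by
  obtain ⟨c, ⟨-, p, hp, hc⟩, rfl, rfl⟩ := h
  obtain ⟨ha, hza⟩ := (hc a (left_mem_Icc.2 hab)).1
  obtain ⟨hb, hzb⟩ := (hc b (right_mem_Icc.2 hab)).1
  have hd (r) (hr : r ∈ Icc a b) :=
    ((hp.differentiableOn one_ne_zero) r hr).hasDerivWithinAt
  have hs (j) (r) (hr : r ∈ Icc a b) :
      HasDerivWithinAt (fun r => (p r).1 j) ((derivWithin p (Icc a b) r).1 j) (Icc a b) r :=
    hasDerivWithinAt_pi.1 (hd r hr).fst j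
  have hx (j) (r) (hr : r ∈ Icc a b) : HasDerivWithinAt (fun r => (p r).2.2.1 j)
      ((derivWithin p (Icc a b) r).2.2.1 j) (Icc a b) r :=
    hasDerivWithinAt_pi.1 (hd r hr).snd.snd.fst j
  have hy (r) (hr : r ∈ Icc a b) : HasDerivWithinAt (fun r => (p r).2.2.2)
      ((derivWithin p (Icc a b) r).2.2.2) (Icc a b) r :=
    (hd r hr).snd.snd.snd
  rw [hza, hzb]
  refine ⟨fun j k => ?_, ?_⟩
  · rw [unitaryMoment_mk, unitaryMoment_mk]
    exact eq_of_hasDerivWithinAt_zero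
      (f := fun r => (p r).2.2.1 j * conj ((p r).2.2.1 k) - conj ((p r).1 j) * (p r).1 k) hab
      (fun r hr => ((hx j r hr).mul (hx k r hr).star).sub ((hs j r hr).star.mul (hs k r hr)))
      (fun r hr => (hc r hr).2.unitary_identity j k)
  · rw [lastMoment_mk, lastMoment_mk]
    exact eq_of_hasDerivWithinAt_zero (f := fun r => conj (p r).2.2.2 * (p r).2.2.2) hab
      (fun r hr => (hy r hr).star.mul (hy r hr)) (fun r hr => (hc r hr).2.last_identity)

/-! ### The vanishing cycle lies in the isotropic sphere. -/

/-- The points of the fibre over `t` with representatives of the form `(x̄, q, x, √(μ - 1))`. -/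
def isotropicSphere (n : ℕ) (μ : ℝ) (t : CP1) : Set (XX n μ) :=
  {z | proj z = t ∧ ∃ (x : Fin (n + 1) → ℂ) (q : ℂ),
    IsRep (fun j => conj (x j), q, x, (Real.sqrt (μ - 1) : ℂ)) z}

/-- A rank-one Hermitian matrix `x x*` determines `x` up to a phase. The phase is read off at an
index where `x` does not vanish. -/
theorem exists_circle_mul_eq {ι : Type*} [Fintype ι] {s x : ι → ℂ}
    (h : ∀ j k, x j * conj (x k) = conj (s j) * s k) :
    ∃ α : Circle, ∀ j, (α : ℂ) * s j = conj (x j) := by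
  have hn (j) : ‖x j‖ = ‖s j‖ := by
    have := congrArg norm (h j j)
    simp only [norm_mul, RCLike.norm_conj] at this
    nlinarith [norm_nonneg (x j), norm_nonneg (s j)]
  by_cases hx : ∃ k, x k ≠ 0
  · obtain ⟨k, hk⟩ := hx
    have hsk : s k ≠ 0 := by rw [← norm_ne_zero_iff, ← hn k]; simpa using hk
    refine ⟨⟨conj (s k) / x k, ?_⟩, fun j => ?_⟩
    · simp [Submonoid.unitSphere, hn, hsk]
    · change conj (s k) / x k * s j = conj (x j)
      have h1 := congrArg conj (h j k)
      simp only [map_mul, Complex.conj_conj] at h1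
      rw [div_mul_eq_mul_div, div_eq_iff hk, h1, mul_comm]
  · push Not at hx
    refine ⟨1, fun j => ?_⟩
    have : s j = 0 := by rw [← norm_eq_zero, ← hn j, hx j]; simp
    simp [this, hx j]

theorem mem_isotropicSphere_of_moments {z : XX n μ}
    (hu : ∀ j k, unitaryMoment j k z.1.1 = 0) (hl : lastMoment z.1.1 = (μ - 1 : ℝ)) :
    z ∈ isotropicSphere n μ (proj z) := by
  obtain ⟨p, hp⟩ := exists_isRep z
  simp only [hp.2, unitaryMoment_mk, sub_eq_zero, lastMoment_mk] at hu hl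
  obtain ⟨β, hβ⟩ := exists_circle_mul_eq_norm p.2.2.2
  obtain ⟨α, hα⟩ := exists_circle_mul_eq hu
  have hy : ‖p.2.2.2‖ = Real.sqrt (μ - 1) := by
    rw [Complex.conj_mul'] at hl
    have : ‖p.2.2.2‖ ^ 2 = μ - 1 := by exact_mod_cast hl
    rw [← this, Real.sqrt_sq (norm_nonneg _)]
  -- `β` makes the last coordinate real and replaces `x` by `β x`; since `α s = x̄`, the factor that
  -- turns `s` into the conjugate of `β x` is `α β⁻¹`.
  refine ⟨rfl, fun j => β * p.2.2.1 j, (α * β⁻¹ : Circle) * β * p.2.1, ?_⟩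
  convert hp.torusAct (α * β⁻¹) β using 1
  refine Prod.ext (funext fun j => ?_) (Prod.ext rfl (Prod.ext rfl ?_))
  · simp only [torusAct, map_mul, ← hα j, Circle.coe_mul, Circle.coe_inv_eq_conj]
    ring
  · simp [torusAct, hβ, hy]

theorem moments_zCrit (hμ : 1 < μ) :
    (∀ j k, unitaryMoment j k (zCrit n hμ).1.1 = 0) ∧
      lastMoment (zCrit n hμ).1.1 = (μ - 1 : ℝ) := by
  refine ⟨fun j k => ?_, ?_⟩
  · rw [zCrit, unitaryMoment_mk]
    simp
  · rw [zCrit, lastMoment_mk, Complex.conj_ofReal, ← Complex.ofReal_mul,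
      Real.mul_self_sqrt (by linarith)]

theorem vanishingCycle_subset_isotropicSphere (hμ : 1 < μ) {γ : ℝ → CP1} {a b : ℝ}
    (hγ : IsEmbeddedPath γ a b) (hb : γ b = CP1.ofComplex 0) :
    vanishingCycle (n := n) hμ γ a b ⊆ isotropicSphere n μ (γ a) := by
  rintro z ⟨hz, hza : proj z = γ a⟩
  have haI : a ∈ Icc a b := left_mem_Icc.2 hγ.lt.le
  rcases hz with rfl | hz
  -- The critical point lies over `γ b ≠ γ a`.
  · exact absurd (hγ.injOn haI (right_mem_Icc.2 hγ.lt.le) (hza.symm.trans hb.symm)) hγ.lt.ne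
  · simp only [mem_iUnion] at hz
    obtain ⟨r, hr, hzr, ρ, hρ, hlim⟩ := hz
    obtain rfl := hγ.injOn (Ico_subset_Icc_self hr) haI (hzr.symm.trans hza)
    have hF : Tendsto (fun r' => (ρ r').1.1) (𝓝[<] b) (𝓝 (zCrit n hμ).1.1) :=
      ((continuous_fst.comp continuous_subtype_val).tendsto _).comp hlim
    have hev : ∀ᶠ r' in 𝓝[<] b, r' ∈ Ico r b := Ico_mem_nhdsLT hγ.lt
    -- A continuous conserved quantity takes the same value at `z` as at the limit of its
    -- transports.
    have huniq {f : FF n μ → ℂ} (hf : Continuous f)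
        (h : ∀ r' ∈ Ico r b, f (ρ r').1.1 = f z.1.1) : f z.1.1 = f (zCrit n hμ).1.1 :=
      tendsto_nhds_unique (tendsto_const_nhds.congr' (hev.mono fun r' hr' => (h r' hr').symm))
        ((hf.tendsto _).comp hF)
    rw [← hza]
    refine mem_isotropicSphere_of_moments (fun j k => ?_) ?_
    · exact (huniq (continuous_unitaryMoment j k)
        fun r' hr' => ((hρ r' hr').moments_eq hr'.1).1 j k).trans ((moments_zCrit hμ).1 j k)
    · exact (huniq continuous_lastMoment
        fun r' hr' => ((hρ r' hr').moments_eq hr'.1).2).trans (moments_zCrit hμ).2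


/-! ### The radius of the sphere and the differential equation for the transport factor. -/

/-- The positive solution `ρ` of `m ρ⁴ + ρ² = 1`. -/
noncomputable def radius (m : ℝ) : ℝ := Real.sqrt (2 / (1 + Real.sqrt (1 + 4 * m)))

theorem radius_pos (m : ℝ) : 0 < radius m := by
  unfold radius
  positivity

theorem radius_eq {m : ℝ} (hm : 0 ≤ m) : m * (radius m ^ 2) ^ 2 + radius m ^ 2 = 1 := by
  have h : (0 : ℝ) ≤ 2 / (1 + Real.sqrt (1 + 4 * m)) := by positivity
  have h1 : Real.sqrt (1 + 4 * m) ^ 2 = 1 + 4 * m := Real.sq_sqrt (by linarith)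
  have h2 : 0 ≤ Real.sqrt (1 + 4 * m) := Real.sqrt_nonneg _
  rw [radius, Real.sq_sqrt h]
  generalize Real.sqrt (1 + 4 * m) = S at *
  have : 1 + S ≠ 0 := by positivity
  field_simp
  linarith

/-- This identifies `|x|²` with `radius (|σ|²) ^ 2`, since both solve the same quadratic equation.
-/
theorem eq_of_quadratic_eq {m A B : ℝ} (hm : 0 ≤ m) (hA : 0 ≤ A) (hB : 0 ≤ B)
    (h : m * A ^ 2 + A = m * B ^ 2 + B) : A = B := by
  have h1 : (A - B) * (m * (A + B) + 1) = 0 := by linear_combination h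
  rcases mul_eq_zero.1 h1 with h2 | h2
  · linarith
  · have : 0 ≤ m * (A + B) := by positivity
    linarith

theorem contDiffOn_radius : ContDiffOn ℝ ∞ radius (Ici 0) := by
  intro m hm
  have hm' : (0 : ℝ) ≤ m := hm
  have h1 : 1 + 4 * m ≠ 0 := by positivity
  have h2 : 2 / (1 + Real.sqrt (1 + 4 * m)) ≠ 0 := by positivity
  have h3 : 1 + Real.sqrt (1 + 4 * m) ≠ 0 := by positivity
  refine ContDiffAt.contDiffWithinAt ?_
  unfold radius
  refine ContDiffAt.sqrt (contDiffAt_const.div (contDiffAt_const.add (ContDiffAt.sqrt ?_ h1)) h3) h2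
  fun_prop

theorem exists_hasDerivWithinAt_Ico {h : ℝ → ℝ} {a b : ℝ} (hab : a < b)
    (hc : ContinuousOn h (Ico a b)) :
    ∃ θ : ℝ → ℝ, θ a = 0 ∧ ∀ r ∈ Ico a b, HasDerivWithinAt θ (h r) (Ico a b) r := by
  -- Extending `h` by a constant to the left of `a` makes every point of `Ico a b` interior, so the
  -- two-sided fundamental theorem of calculus applies.
  have hH : ContinuousOn (fun r => h (max a r)) (Iio b) :=
    hc.comp (by fun_prop) fun r hr => ⟨le_max_left _ _, max_lt hab hr⟩
  refine ⟨fun r => ∫ s in a..r, h (max a s), by simp, fun r hr => ?_⟩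
  have hsub : uIcc a r ⊆ Iio b := by
    rw [uIcc_of_le hr.1]
    exact fun s hs => hs.2.trans_lt hr.2
  have := intervalIntegral.integral_hasDerivAt_right ((hH.mono hsub).intervalIntegrable)
    (hH.stronglyMeasurableAtFilter isOpen_Iio r hr.2) (hH.continuousAt (Iio_mem_nhds hr.2))
  rw [max_eq_right hr.1] at this
  exact this.hasDerivWithinAt

theorem contDiffOn_one_of_hasDerivWithinAt {F : Type*} [NormedAddCommGroup F] [NormedSpace ℝ F]
    {f f' : ℝ → F} {s : Set ℝ} (hs : UniqueDiffOn ℝ s)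
    (hf : ∀ r ∈ s, HasDerivWithinAt f (f' r) s r) (hf' : ContinuousOn f' s) :
    ContDiffOn ℝ 1 f s := by
  rw [show (1 : WithTop ℕ∞) = 0 + 1 from rfl, contDiffOn_succ_iff_derivWithin hs]
  refine ⟨fun r hr => (hf r hr).differentiableWithinAt, by simp, ?_⟩
  rw [contDiffOn_zero]
  exact hf'.congr fun r hr => (hf r hr).derivWithin (hs r hr)

/-- Parallel transport of the spheres along the path `[1 : σ]`: `ζ` is the factor by which a
point of the unit sphere is multiplied, and `κ` is its logarithmic derivative. -/
theorem exists_transport_factor {σ : ℝ → ℂ} {a b : ℝ} (hab : a < b)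
    (hσ : ContDiffOn ℝ ∞ σ (Ico a b)) :
    ∃ ζ κ q' : ℝ → ℂ, ζ a = radius (‖σ a‖ ^ 2) ∧ ContDiffOn ℝ 1 ζ (Ico a b) ∧
      ∀ r ∈ Ico a b, ‖ζ r‖ = radius (‖σ r‖ ^ 2) ∧
        HasDerivWithinAt ζ (κ r * ζ r) (Ico a b) r ∧
        HasDerivWithinAt (fun r => σ r * (‖ζ r‖ ^ 2 : ℝ)) (q' r) (Ico a b) r ∧
        conj (σ r) * q' r =
          -κ r - 2 * Complex.I * (κ r).im * (σ r * (‖ζ r‖ ^ 2 : ℝ)) * conj (σ r) := by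
  set S := Ico a b
  have hS : UniqueDiffOn ℝ S := uniqueDiffOn_Ico a b
  set m : ℝ → ℝ := fun r => ‖σ r‖ ^ 2
  set ρ : ℝ → ℝ := fun r => radius (m r)
  have hm : ContDiffOn ℝ ∞ m S := hσ.norm_sq ℝ
  have hρ : ContDiffOn ℝ ∞ ρ S := contDiffOn_radius.comp hm fun r _ => sq_nonneg ‖σ r‖
  have hρpos (r) : 0 < ρ r := radius_pos _
  have hρeq (r) : m r * (ρ r ^ 2) ^ 2 + ρ r ^ 2 = 1 := radius_eq (sq_nonneg _)
  set σ' := derivWithin σ S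
  set ρ' := derivWithin ρ S
  have hσ' : ∀ r ∈ S, HasDerivWithinAt σ (σ' r) S r := fun r hr =>
    (hσ.differentiableOn (by simp) r hr).hasDerivWithinAt
  have hρ' : ∀ r ∈ S, HasDerivWithinAt ρ (ρ' r) S r := fun r hr =>
    (hρ.differentiableOn (by simp) r hr).hasDerivWithinAt
  have hσ'c : ContinuousOn σ' S := hσ.continuousOn_derivWithin hS (by simp)
  have hρ'c : ContinuousOn ρ' S := hρ.continuousOn_derivWithin hS (by simp)
  -- The imaginary part of the required identity is a linear equation for the phase velocity `θ' =
  -- Im κ`; this is its solution.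
  set θ' : ℝ → ℝ := fun r => -(conj (σ r) * σ' r).im * ρ r ^ 2 / (1 + 2 * ρ r ^ 2 * m r)
  have hden (r) : 1 + 2 * ρ r ^ 2 * m r ≠ 0 := by
    have : 0 ≤ m r := sq_nonneg _
    positivity
  have hσc := hσ.continuousOn
  have hρc := hρ.continuousOn
  have hmc := hm.continuousOn
  have hθ'c : ContinuousOn θ' S := by
    have h1 : ContinuousOn (fun r => conj (σ r)) S := Complex.continuous_conj.comp_continuousOn hσc
    have h2 : ContinuousOn (fun r => (conj (σ r) * σ' r).im) S :=
      Complex.continuous_im.comp_continuousOn (h1.mul hσ'c)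
    exact (h2.neg.mul (hρc.pow 2)).div
      (continuousOn_const.add ((continuousOn_const.mul (hρc.pow 2)).mul hmc)) fun r _ => hden r
  obtain ⟨θ, hθa, hθ⟩ := exists_hasDerivWithinAt_Ico hab hθ'c
  set ζ : ℝ → ℂ := fun r => (ρ r : ℂ) * Complex.exp (θ r * Complex.I)
  set κ : ℝ → ℂ := fun r => (ρ' r / ρ r : ℝ) + (θ' r : ℝ) * Complex.I
  have hζn (r) : ‖ζ r‖ = ρ r := by
    simp only [ζ, norm_mul, Complex.norm_exp_ofReal_mul_I, mul_one, Complex.norm_real,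
      Real.norm_eq_abs, abs_of_pos (hρpos r)]
  have hζ : ∀ r ∈ S, HasDerivWithinAt ζ (κ r * ζ r) S r := by
    intro r hr
    have h1 := (hρ' r hr).ofReal_comp
    have h2 := ((hθ r hr).ofReal_comp.mul_const Complex.I).cexp
    refine (h1.mul h2).congr_deriv ?_
    have : (ρ r : ℂ) ≠ 0 := by exact_mod_cast (hρpos r).ne'
    simp only [κ, ζ]
    push_cast
    field_simp
  refine ⟨ζ, κ, fun r => σ' r * (ρ r ^ 2 : ℝ) + σ r * (2 * ρ r * ρ' r : ℝ), ?_, ?_,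
    fun r hr => ⟨hζn r, hζ r hr, ?_, ?_⟩⟩
  · simp [ζ, hθa, ρ, m]
  · refine contDiffOn_one_of_hasDerivWithinAt hS hζ (ContinuousOn.mul ?_ ?_)
    · exact (Complex.continuous_ofReal.comp_continuousOn
        (hρ'c.div hρc fun r _ => (hρpos r).ne')).add
        ((Complex.continuous_ofReal.comp_continuousOn hθ'c).mul continuousOn_const)
    · exact fun r hr => (hζ r hr).continuousWithinAt
  · simp only [hζn]
    refine ((hσ' r hr).mul ((hρ' r hr).pow 2).ofReal_comp).congr_deriv ?_
    simp
  · have hmd : HasDerivWithinAt m (2 * (conj (σ r) * σ' r).re) S r := by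
      refine (hσ' r hr).norm_sq.congr_deriv ?_
      simp [Complex.inner, mul_comm]
    -- Differentiating `m ρ⁴ + ρ² = 1` and dividing by `2 ρ²` gives the real part of the required
    -- identity.
    have hE := (hmd.mul (((hρ' r hr).pow 2).pow 2)).add ((hρ' r hr).pow 2)
    have hE' : HasDerivWithinAt (fun r => m r * (ρ r ^ 2) ^ 2 + ρ r ^ 2) 0 S r := by
      simp only [hρeq]
      exact hasDerivWithinAt_const _ _ _
    have hEq := (hS r hr).eq_deriv _ hE hE'
    have hpos := hρpos r
    have hκre : (κ r).re = ρ' r / ρ r := by simp [κ]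
    have hκim : (κ r).im = θ' r := by simp [κ]
    have hθeq : θ' r * (1 + 2 * ρ r ^ 2 * m r) = -(conj (σ r) * σ' r).im * ρ r ^ 2 :=
      div_mul_cancel₀ _ (hden r)
    have hmσ : m r = (σ r).re ^ 2 + (σ r).im ^ 2 := by
      simp only [m, ← Complex.normSq_eq_norm_sq, Complex.normSq_apply]; ring
    have hρeq' : ρ' r / ρ r =
        -(conj (σ r) * σ' r).re * ρ r ^ 2 - m r * (2 * ρ r * ρ' r) := by
      rw [div_eq_iff hpos.ne']
      simp only [Pi.pow_apply, Nat.cast_ofNat, Nat.add_one_sub_one, pow_one] at hEq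
      have : 2 * ρ r ≠ 0 := by positivity
      refine mul_left_cancel₀ this ?_
      linear_combination hEq
    simp only [Complex.mul_re, Complex.mul_im, Complex.conj_re, Complex.conj_im] at hθeq hρeq'
    apply Complex.ext
    · simp [hκre, hκim, hζn, -Complex.ofReal_pow]
      rw [hρeq', hmσ]
      ring
    · simp [hκim, hζn, -Complex.ofReal_pow]
      rw [hmσ] at hθeq
      linear_combination hθeq


/-! ### The isotropic sphere lies in the vanishing cycle. -/

/-- For vertical `v`, put `A = ∑ x_j v_{s,j}` and `B = ∑ x̄_j v_{x,j}`. The fibre equation gives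
`v_q = σ (A + B)`, and the hypothesis on `q'` then reduces the pairing to `2 Im κ · Re (A + q̄
v_q)`, which vanishes by tangency to the level set. -/
theorem isHorizontal_transport {t : CP1} {σ q q' κ : ℂ} (h0 : t.rep 0 ≠ 0)
    (h1 : t.rep 1 = σ * t.rep 0)
    (h : conj σ * q' = -κ - 2 * Complex.I * κ.im * q * conj σ) (x : Fin (n + 1) → ℂ) (y : ℂ) :
    IsHorizontal (n := n) t (fun j => conj (x j), q, x, y)
      (fun j => conj (κ * x j), q', fun j => κ * x j, 0) := by
  intro v hv
  obtain ⟨hv1, -, hv2⟩ := isVertical_iff.1 hv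
  simp only [Complex.conj_conj] at hv1 hv2
  set A := ∑ j, x j * v.1 j with hA
  set B := ∑ j, conj (x j) * v.2.2.1 j with hB
  have hq : v.2.1 = σ * (A + B) := by
    refine mul_left_cancel₀ h0 ?_
    rw [← hv2, h1, hA, hB, ← Finset.sum_add_distrib]
    simp only [mul_comm (x _)]
    ring
  have hc := congrArg conj h
  simp only [map_mul, map_sub, map_neg, Complex.conj_conj, Complex.conj_I, Complex.conj_ofReal,
    map_ofNat] at hc
  have hκ : κ - conj κ = 2 * κ.im * Complex.I := by
    rw [Complex.sub_conj]; push_cast; ring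
  have hω : (∑ j, conj (conj (κ * x j)) * v.1 j) + conj q' * v.2.1
      + (∑ j, conj (κ * x j) * v.2.2.1 j) + conj (0 : ℂ) * v.2.2.2
      = (2 * κ.im : ℝ) * (A + conj q * v.2.1) * Complex.I := by
    have e1 : ∑ j, conj (conj (κ * x j)) * v.1 j = κ * A := by
      simp only [hA, Complex.conj_conj, Finset.mul_sum, mul_assoc]
    have e2 : ∑ j, conj (κ * x j) * v.2.2.1 j = conj κ * B := by
      simp only [hB, map_mul, Finset.mul_sum, mul_assoc]
    rw [e1, e2, hq, map_zero]
    push_cast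
    linear_combination (A + B) * hc + A * hκ
  rw [omegaStd]
  simp only
  rw [hω, Complex.mul_I_im, Complex.re_ofReal_mul, hv1, mul_zero]

theorem isHorizontal_zero (t : CP1) (p : Coord n) : IsHorizontal t p 0 := by
  intro v _
  simp [omegaStd]

theorem IsEmbeddedPath.exists_coordinates {γ : ℝ → CP1} {a b : ℝ} (hγ : IsEmbeddedPath γ a b)
    (hb : γ b = CP1.ofComplex 0) :
    ∃ u : ℝ → Fin 2 → ℂ, ContDiffOn ℝ ∞ u (Icc a b) ∧
      (∀ r ∈ Icc a b, ∃ h : u r ≠ 0, γ r = Projectivization.mk ℂ (u r) h) ∧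
      (∀ r ∈ Ico a b, u r 0 ≠ 0) ∧ u b 0 = 0 ∧ u b 1 ≠ 0 := by
  obtain ⟨u, hu, hγu⟩ := hγ.smooth
  have hbI : b ∈ Icc a b := right_mem_Icc.2 hγ.lt.le
  refine ⟨u, hu, fun r hr => (hγu r hr).1, fun r hr h0 => ?_, ?_⟩
  · obtain ⟨h, hr'⟩ := (hγu r (Ico_subset_Icc_self hr)).1
    have h1 : u r 1 ≠ 0 := fun h1 => h (funext fun i => by fin_cases i <;> simp [h0, h1])
    refine hr.2.ne (hγ.injOn (Ico_subset_Icc_self hr) hbI ?_)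
    rw [hr', hb, CP1.ofComplex, Projectivization.mk_eq_mk_iff']
    refine ⟨u r 1, funext fun i => ?_⟩
    fin_cases i <;> simp [h0]
  · obtain ⟨h, hb'⟩ := (hγu b hbI).1
    rw [hb', CP1.ofComplex, Projectivization.mk_eq_mk_iff'] at hb
    obtain ⟨c, hc⟩ := hb
    have h0 : u b 0 = 0 := by rw [← hc]; simp
    exact ⟨h0, fun h1 => h (funext fun i => by fin_cases i <;> simp [h0, h1])⟩

theorem sum_conj_mul_self {ι : Type*} [Fintype ι] (x : ι → ℂ) :
    ∑ j, conj (x j) * x j = ((∑ j, ‖x j‖ ^ 2 : ℝ) : ℂ) := by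
  simp only [Complex.conj_mul']
  push_cast
  rfl

theorem isotropicSphere_subset_vanishingCycle (hμ : 1 < μ) {γ : ℝ → CP1} {a b : ℝ}
    (hγ : IsEmbeddedPath γ a b) (hb : γ b = CP1.ofComplex 0) :
    isotropicSphere n μ (γ a) ⊆ vanishingCycle (n := n) hμ γ a b := by
  rintro z ⟨hza, x, q, hz⟩
  obtain ⟨u, hu, hγu, hu0, hub0, hub1⟩ := hγ.exists_coordinates hb
  have haS : a ∈ Ico a b := left_mem_Ico.2 hγ.lt
  have hci (i) : ContDiffOn ℝ ∞ (fun r => u r i) (Icc a b) := contDiffOn_pi.1 hu i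
  -- The coordinate `1 / t` is finite on the path before its endpoint and covers a start at `∞`,
  -- where `σ = 0`.
  set σ : ℝ → ℂ := fun r => u r 1 / u r 0 with hσdef
  have hσu : ∀ r ∈ Ico a b, σ r * u r 0 = u r 1 := fun r hr => div_mul_cancel₀ _ (hu0 r hr)
  have hσ : ContDiffOn ℝ ∞ σ (Ico a b) :=
    ((hci 1).mono Ico_subset_Icc_self).mul (((hci 0).mono Ico_subset_Icc_self).inv hu0)
  obtain ⟨ζ, κ, q', hζa, hζ, hall⟩ := exists_transport_factor hγ.lt hσ
  have hρpos (r) := radius_pos (‖σ r‖ ^ 2)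
  have hρeq : ∀ r ∈ Ico a b, ‖σ r‖ ^ 2 * (‖ζ r‖ ^ 2) ^ 2 + ‖ζ r‖ ^ 2 = 1 := fun r hr => by
    rw [(hall r hr).1]; exact radius_eq (sq_nonneg _)
  -- the initial point
  have hlev := mem_levelSet_iff.1 hz.mem
  simp only [RCLike.norm_conj] at hlev
  set G := ∑ j, ‖x j‖ ^ 2 with hG
  have hqa : q = σ a * (G : ℝ) := by
    have h := hz.fibreEq_eq_zero
    obtain ⟨hne, hγa⟩ := hγu a (Ico_subset_Icc_self haS)
    rw [hza, hγa, fibreEq_mk_eq_zero_iff] at h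
    simp only [sum_conj_mul_self, ← hG] at h
    refine mul_left_cancel₀ (hu0 a haS) ?_
    rw [← h, ← hσu a haS]
    ring
  have hGρ : G = radius (‖σ a‖ ^ 2) ^ 2 := by
    refine eq_of_quadratic_eq (sq_nonneg ‖σ a‖) (Finset.sum_nonneg fun _ _ => sq_nonneg _)
      (sq_nonneg _) ?_
    rw [radius_eq (sq_nonneg _), ← hlev.1, hqa, norm_mul, mul_pow, Complex.norm_real,
      Real.norm_eq_abs, sq_abs]
    ring
  have hρa : (radius (‖σ a‖ ^ 2) : ℂ) ≠ 0 := by exact_mod_cast (hρpos a).ne'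
  set ξ : Fin (n + 1) → ℂ := fun j => x j / radius (‖σ a‖ ^ 2) with hξdef
  have hξ : ∑ j, ‖ξ j‖ ^ 2 = 1 := by
    simp only [hξdef, norm_div, Complex.norm_real, Real.norm_eq_abs, div_pow, sq_abs]
    rw [← Finset.sum_div, ← hG, hGρ, div_self (pow_pos (hρpos a) 2).ne']
  -- the horizontal lift
  set P : ℝ → Coord n := fun r => (fun j => conj (ζ r * ξ j), σ r * (‖ζ r‖ ^ 2 : ℝ),
    fun j => ζ r * ξ j, (Real.sqrt (μ - 1) : ℂ)) with hP
  have hsum (r) : ∑ j, ‖ζ r * ξ j‖ ^ 2 = ‖ζ r‖ ^ 2 := by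
    simp only [norm_mul, mul_pow, ← Finset.mul_sum, hξ, mul_one]
  have hqn (r) : ‖σ r * (‖ζ r‖ ^ 2 : ℝ)‖ ^ 2 = ‖σ r‖ ^ 2 * (‖ζ r‖ ^ 2) ^ 2 := by
    rw [norm_mul, mul_pow, Complex.norm_real, Real.norm_eq_abs, sq_abs]
  have hPlev : ∀ r ∈ Ico a b, P r ∈ levelSet n μ := by
    intro r hr
    rw [mem_levelSet_iff]
    simp only [hP, RCLike.norm_conj, hsum, hqn, Complex.norm_real, Real.norm_eq_abs, sq_abs]
    rw [Real.sq_sqrt (by linarith : 0 ≤ μ - 1), add_comm (‖ζ r‖ ^ 2), hρeq r hr]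
    exact ⟨rfl, by ring⟩
  have hex : ∀ r ∈ Ico a b, ∃ z' : XX n μ, proj z' = γ r ∧ IsRep (P r) z' := by
    intro r hr
    refine ⟨⟨(FF.mk (P r) (hPlev r hr), γ r), P r, hPlev r hr, rfl, ?_⟩, rfl, hPlev r hr, rfl⟩
    obtain ⟨hne, hγr⟩ := hγu r (Ico_subset_Icc_self hr)
    simp only [hγr]
    rw [fibreEq_mk_eq_zero_iff]
    simp only [hP, sum_conj_mul_self, hsum]
    rw [← hσu r hr]
    ring
  have : Nonempty (XX n μ) := ⟨z⟩
  choose! c hcπ hc using hex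
  have hca : c a = z := by
    refine XX.ext_of_isRep (hc a haS) ?_ ((hcπ a haS).trans hza.symm)
    convert hz using 1
    have e (j) : ζ a * ξ j = x j := by
      simp only [hξdef, hζa]
      exact mul_div_cancel₀ _ hρa
    simp only [hP, e]
    rw [(hall a haS).1, ← hGρ, hqa]
  have hζd (j) : ContDiffOn ℝ 1 (fun r => ζ r * ξ j) (Ico a b) := hζ.mul contDiffOn_const
  have hPd : ContDiffOn ℝ 1 P (Ico a b) := by
    refine ContDiffOn.prodMk (contDiffOn_pi.2 fun j => ?_) (ContDiffOn.prodMk ?_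
      (ContDiffOn.prodMk (contDiffOn_pi.2 hζd) contDiffOn_const))
    · exact Complex.conjCLE.contDiff.comp_contDiffOn (hζd j)
    · exact (hσ.of_le (by simp)).mul (Complex.ofRealCLM.contDiff.comp_contDiffOn (hζ.norm_sq ℝ))
  have hP' : ∀ r ∈ Ico a b, HasDerivWithinAt P (fun j => conj (κ r * (ζ r * ξ j)), q' r,
      fun j => κ r * (ζ r * ξ j), 0) (Ico a b) r := by
    intro r hr
    obtain ⟨-, h1, h2, -⟩ := hall r hr
    have h3 (j) : HasDerivWithinAt (fun r => ζ r * ξ j) (κ r * (ζ r * ξ j)) (Ico a b) r := by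
      rw [← mul_assoc]
      exact h1.mul_const _
    exact (hasDerivWithinAt_pi.2 fun j => (h3 j).star).prodMk
      (h2.prodMk ((hasDerivWithinAt_pi.2 h3).prodMk (hasDerivWithinAt_const _ _ _)))
  have hhor : ∀ r ∈ Ico a b, IsHorizontal (γ r) (P r) (fun j => conj (κ r * (ζ r * ξ j)), q' r,
      fun j => κ r * (ζ r * ξ j), 0) := by
    intro r hr
    obtain ⟨hne, hγr⟩ := hγu r (Ico_subset_Icc_self hr)
    obtain ⟨d, hd, hrep⟩ := rep_mk (u r) hne
    rw [← hγr] at hrep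
    refine isHorizontal_transport (σ := σ r) ?_ ?_ (hall r hr).2.2.2 _ _
    · rw [hrep]
      exact mul_ne_zero hd (hu0 r hr)
    · rw [hrep, hrep, ← hσu r hr]
      ring
  refine ⟨Or.inr ?_, hza⟩
  simp only [mem_iUnion]
  refine ⟨a, haS, hza, c, fun r' hr' => ⟨c, ⟨?_, P, ?_, ?_⟩, hca, rfl⟩, ?_⟩
  · exact fun r hr => hcπ r ⟨hr.1, hr.2.trans_lt hr'.2⟩
  · exact hPd.mono fun r hr => ⟨hr.1, hr.2.trans_lt hr'.2⟩
  · intro r hr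
    have hsub : Icc a r' ⊆ Ico a b := fun s hs => ⟨hs.1, hs.2.trans_lt hr'.2⟩
    refine ⟨hc r (hsub hr), ?_⟩
    rcases hr'.1.eq_or_lt with rfl | hlt
    -- On a one-point interval `derivWithin` has the default value `0`, which is horizontal.
    · rw [Icc_self, derivWithin_zero_of_not_accPt]
      · exact isHorizontal_zero _ _
      · obtain rfl : r = a := le_antisymm hr.2 hr.1
        rw [accPt_principal_iff_nhdsWithin]
        simp
    · rw [((hP' r (hsub hr)).mono hsub).derivWithin (uniqueDiffOn_Icc hlt r hr)]
      exact hhor r (hsub hr)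
  -- convergence to the critical point
  · have hev : ∀ᶠ r in 𝓝[<] b, r ∈ Ico a b := Ico_mem_nhdsLT hγ.lt
    have hulim : Tendsto u (𝓝[<] b) (𝓝 (u b)) :=
      (hu.continuousOn b (right_mem_Icc.2 hγ.lt.le)).mono_left
        (nhdsWithin_le_of_mem (mem_of_superset (Ico_mem_nhdsLT hγ.lt) Ico_subset_Icc_self))
    have hui (i) : Tendsto (fun r => ‖u r i‖) (𝓝[<] b) (𝓝 ‖u b i‖) :=
      ((tendsto_pi_nhds.1 hulim) i).norm
    -- The level set equation gives `|σ| |ζ|² ≤ 1`, hence `|ζ|² ≤ |u₀| / |u₁|`, and `u₀ → 0` at the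
    -- endpoint.
    have hζ2 : Tendsto (fun r => ‖ζ r‖ ^ 2) (𝓝[<] b) (𝓝 0) := by
      have hq : Tendsto (fun r => ‖u r 0‖ / ‖u r 1‖) (𝓝[<] b) (𝓝 0) := by
        have := (hui 0).div (hui 1) (by simpa using hub1)
        simpa [hub0, Pi.div_def] using this
      refine squeeze_zero' (Eventually.of_forall fun r => sq_nonneg _) ?_ hq
      filter_upwards [hev, (hui 1).eventually_ne (norm_ne_zero_iff.2 hub1)] with r hr h1
      have h1' : 0 < ‖u r 1‖ := lt_of_le_of_ne (norm_nonneg _) (Ne.symm h1)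
      have h0' : 0 < ‖u r 0‖ := by simpa using hu0 r hr
      rw [le_div_iff₀ h1', ← hσu r hr, norm_mul]
      have : ‖σ r‖ * ‖ζ r‖ ^ 2 ≤ 1 := by
        refine abs_le_of_sq_le_sq' ?_ zero_le_one |>.2
        nlinarith [hρeq r hr, sq_nonneg ‖ζ r‖]
      nlinarith
    have hζ0 : Tendsto (fun r => ‖ζ r‖) (𝓝[<] b) (𝓝 0) := by
      simpa using hζ2.sqrt
    -- The phase of `q` need not converge; rotating by `α` makes `q` real and nonnegative without
    -- changing the class.
    choose α hα using fun r => exists_circle_mul_eq_norm (σ r * (‖ζ r‖ ^ 2 : ℝ))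
    have hqlim : Tendsto (fun r => ‖σ r * (‖ζ r‖ ^ 2 : ℝ)‖) (𝓝[<] b) (𝓝 1) := by
      have h1 : Tendsto (fun r => Real.sqrt (1 - ‖ζ r‖ ^ 2)) (𝓝[<] b) (𝓝 1) := by
        simpa using (hζ2.const_sub 1).sqrt
      refine h1.congr' (hev.mono fun r hr => ?_)
      rw [← hρeq r hr, add_sub_cancel_right, ← hqn, Real.sqrt_sq (norm_nonneg _)]
    refine (Topology.IsInducing.subtypeVal (t := {z : FF n μ × CP1 | ∃ (p : Coord n)
      (hp : p ∈ levelSet n μ), z.1 = FF.mk p hp ∧ fibreEq z.2 p = 0})).tendsto_nhds_iff.2 ?_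
    refine Tendsto.prodMk_nhds
      (tendsto_FF_mk (P := fun r => torusAct (α r) 1 (P r)) _ ?_ ?_) ?_
    · have hx (j) : Tendsto (fun r => ‖ζ r‖ * ‖ξ j‖) (𝓝[<] b) (𝓝 0) := by
        simpa using hζ0.mul_const ‖ξ j‖
      refine Tendsto.prodMk_nhds (tendsto_pi_nhds.2 fun j => ?_) (Tendsto.prodMk_nhds ?_
        (Tendsto.prodMk_nhds (tendsto_pi_nhds.2 fun j => ?_) ?_))
      · refine tendsto_zero_iff_norm_tendsto_zero.2 ((hx j).congr fun r => ?_)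
        simp [hP, Circle.norm_coe]
      · simp only [hP, Circle.coe_one, mul_one, hα]
        exact_mod_cast (Complex.continuous_ofReal.tendsto 1).comp hqlim
      · refine tendsto_zero_iff_norm_tendsto_zero.2 ((hx j).congr fun r => ?_)
        simp [hP]
      · simp [hP]
    · exact hev.mono fun r hr => (hc r hr).torusAct (α r) 1
    · rw [← hb]
      obtain ⟨hne, hγb⟩ := hγu b (right_mem_Icc.2 hγ.lt.le)
      rw [hγb]
      refine tendsto_CP1_mk hne hulim (hev.mono fun r hr => ?_)
      obtain ⟨h, h'⟩ := hγu r (Ico_subset_Icc_self hr)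
      exact ⟨h, (hcπ r hr).trans h'⟩

theorem vanishingCycle_eq_isotropicSphere (hμ : 1 < μ) {γ : ℝ → CP1} {a b : ℝ}
    (hγ : IsEmbeddedPath γ a b) (hb : γ b = CP1.ofComplex 0) :
    vanishingCycle (n := n) hμ γ a b = isotropicSphere n μ (γ a) :=
  (vanishingCycle_subset_isotropicSphere hμ hγ hb).antisymm
    (isotropicSphere_subset_vanishingCycle hμ hγ hb)

/-! ### Comparison with the explicit spheres and conclusion. -/

theorem isotropicSphere_ofComplex {t : ℝ} (ht : 0 < t) :
    isotropicSphere n μ (CP1.ofComplex t) = sphere n μ t := by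
  refine Subset.antisymm ?_ ?_
  · rintro z ⟨hz, x, q, hrep⟩
    have hlev := (mem_levelSet_iff.1 hrep.mem).1
    have hf := hrep.fibreEq_eq_zero
    rw [hz, CP1.ofComplex, fibreEq_mk_eq_zero_iff] at hf
    simp only [sum_conj_mul_self] at hf
    simp only [RCLike.norm_conj] at hlev
    have hG0 : 0 ≤ ∑ j, ‖x j‖ ^ 2 := Finset.sum_nonneg fun _ _ => sq_nonneg _
    have ht' : (t : ℂ) ≠ 0 := by exact_mod_cast ht.ne'
    have hq : q = ((∑ j, ‖x j‖ ^ 2) / t : ℝ) := by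
      rw [Complex.ofReal_div, eq_div_iff ht']
      simpa [mul_comm] using hf.symm
    rw [hq, Complex.norm_real, Real.norm_eq_abs, sq_abs] at hlev
    generalize hG : ∑ j, ‖x j‖ ^ 2 = G at *
    have hg : G = g t := by
      -- With `q = G / t` the level set equation reads `G² + t² G = t²`; completing the square gives
      -- this root.
      have : Real.sqrt (t ^ 4 + 4 * t ^ 2) = 2 * G + t ^ 2 := by
        rw [Real.sqrt_eq_iff_mul_self_eq_of_pos (by positivity)]
        field_simp at hlev
        linear_combination 4 * hlev
      rw [g, this]
      ring
    refine ⟨hz, x, hG.trans hg, ?_⟩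
    have : Real.sqrt (1 - g t) = G / t := by
      rw [← hg, ← hlev, add_sub_cancel_left, Real.sqrt_sq (by positivity)]
    rwa [this, ← hq]
  · rintro z ⟨hz, x, -, hrep⟩
    exact ⟨hz, x, _, hrep⟩

theorem isotropicSphere_infinity :
    isotropicSphere n μ CP1.infinity = sphereAtInfinity n μ := by
  refine Subset.antisymm ?_ ?_
  · rintro z ⟨hz, x, q, hrep⟩
    have hlev := (mem_levelSet_iff.1 hrep.mem).1
    have hf := hrep.fibreEq_eq_zero
    rw [hz, CP1.infinity, fibreEq_mk_eq_zero_iff] at hf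
    have hq : q = 0 := by simpa using hf.symm
    subst hq
    exact ⟨hz, x, by simpa using hlev, hrep⟩
  · rintro z ⟨hz, x, -, hrep⟩
    exact ⟨hz, x, _, hrep⟩

theorem SymplecticallyIsotopic.refl {t : CP1} {V : Set (XX n μ)} (hV : V ⊆ {z | proj z = t}) :
    SymplecticallyIsotopic t V V := by
  refine ⟨hV, hV, fun _ => Equiv.refl _, rfl, fun _ _ _ _ _ _ hf => hf, fun _ _ _ _ _ _ hf => hf,
    fun _ U f p hU hp hf y hy => ⟨U, hU, hy, p, hp, hf, fun _ _ => rfl⟩, ?_⟩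
  simp

theorem isotropicSphere_subset_fibre (t : CP1) : isotropicSphere n μ t ⊆ {z | proj z = t} :=
  fun _ hz => hz.1

end VanishingCycle

theorem proposition3 (n : ℕ) (μ : ℝ) (hμ : 1 < μ) :
    (∀ t : ℝ, 0 < t → ∀ (γ : ℝ → VanishingCycle.CP1) (a b : ℝ),
      VanishingCycle.IsEmbeddedPath γ a b →
      γ a = VanishingCycle.CP1.ofComplex t → γ b = VanishingCycle.CP1.ofComplex 0 →
      VanishingCycle.SymplecticallyIsotopic (VanishingCycle.CP1.ofComplex t)
        (VanishingCycle.vanishingCycle (n := n) hμ γ a b)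
        (VanishingCycle.sphere n μ t)) ∧
    (∀ (γ : ℝ → VanishingCycle.CP1) (a b : ℝ),
      VanishingCycle.IsEmbeddedPath γ a b →
      γ a = VanishingCycle.CP1.infinity → γ b = VanishingCycle.CP1.ofComplex 0 →
      VanishingCycle.SymplecticallyIsotopic VanishingCycle.CP1.infinity
        (VanishingCycle.vanishingCycle (n := n) hμ γ a b)
        (VanishingCycle.sphereAtInfinity n μ)) := by
  refine ⟨fun t ht γ a b hγ ha hb => ?_, fun γ a b hγ ha hb => ?_⟩
  · rw [VanishingCycle.vanishingCycle_eq_isotropicSphere hμ hγ hb, ha,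
      ← VanishingCycle.isotropicSphere_ofComplex ht]
    exact .refl (VanishingCycle.isotropicSphere_subset_fibre _)
  · rw [VanishingCycle.vanishingCycle_eq_isotropicSphere hμ hγ hb, ha,
      ← VanishingCycle.isotropicSphere_infinity]
    exact .refl (VanishingCycle.isotropicSphere_subset_fibre _)
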